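/- Let $\mathfrak g$ be a real Lie algebra of dimension 4 that is unimodular, i.e. $\operatorname{tr}(\operatorname{ad}_\xi)=0$ for every $\xi\in\mathfrak g$. Let $J:\mathfrak g\to\mathfrak g$ be an almost complex structure, i.e. a linear map with $J^2=-\mathrm{id}$. Let $H^2(\mathfrak g)$ be the space of closed real 2-forms modulo the exact ones in the Chevalley–Eilenberg complex $(\Lambda^*(\mathfrak g^*),d)$, where $d\phi(u,v)=-\phi([u,v])$ for $\phi\in\mathfrak g^*$. Let $H_J^{\pm}(\mathfrak g)\subset H^2(\mathfrak g)$ be the subspace of classes represented by a closed 2-form $\alpha$ with $\alpha(J\cdot,J\cdot)=\pm\alpha$. A closed 2-form $\omega$ is called $J$-tamed if $\omega(v,Jv)>0$ for all $v\neq 0$, and $J$-compatible if in addition $\omega(J\cdot,J\cdot)=\omega$. Put $$\mathcal K_J^t=\{[\omega]\in H^2(\mathfrak g) : \omega \text{ is } J\text{-tamed}\},\qquad \mathcal K_J^c=\{[\omega]\in H^+_J(\mathfrak g) : \omega \text{ is } J\text{-compatible}\}.$$ Fix a nonzero $\zeta\in\Lambda^4(\mathfrak g)$ inducing the orientation of $\mathfrak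 g$ determined by $J$ (that is, $\zeta=v\wedge Jv\wedge w\wedge Jw$ for some $v,w\in\mathfrak g$). For $e=[\alpha]\in H^2(\mathfrak g)$ put $e^2=(\alpha\wedge\alpha)(\zeta)$; since $\mathfrak g$ is unimodular, this does not depend on the choice of the closed form $\alpha$ representing $e$. **Theorem.** Suppose that $J$ is tamed, i.e. that a $J$-tamed closed 2-form exists. Then the $J$-compatible cone $\mathcal K_J^c$ is a connected component of $$\mathcal P_J=\{e\in H_J^+(\mathfrak g) : e^2>0\}$$ (with its topology as a subset of a finite-dimensional real vector space), and the $J$-tamed cone is $$\mathcal K_J^t=\mathcal K_J^c+H_J^-(\mathfrak g).$$ -/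

import Mathlib

open scoped Pointwise

noncomputable section

namespace LieACS

/-- A finite-dimensional real Lie algebra is unimodular if `tr (ad ξ) = 0` for every `ξ`. -/
def IsUnimodular (g : Type*) [LieRing g] [LieAlgebra ℝ g] : Prop :=
  ∀ ξ : g, LinearMap.trace ℝ g (LieAlgebra.ad ℝ g ξ) = 0

/-- An almost complex structure: a linear endomorphism `J` with `J² = -id`. -/
def IsAlmostComplex {g : Type*} [AddCommGroup g] [Module ℝ g] (J : g →ₗ[ℝ] g) : Prop :=
  ∀ v : g, J (J v) = -v

/-- Real `k`-forms on `g`, the elements of `Λᵏ(g*)`. -/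
abbrev Form (g : Type*) [LieRing g] [LieAlgebra ℝ g] (k : ℕ) : Type _ :=
  g [⋀^Fin k]→ₗ[ℝ] ℝ

variable {g : Type*} [LieRing g] [LieAlgebra ℝ g]

/-! ### The Chevalley-Eilenberg complex in degrees 1, 2, 3 and second cohomology -/

theorem form_two_apply (ω : Form g 2) (v : Fin 2 → g) : ω v = ω ![v 0, v 1] := by
  congr 1
  ext i
  fin_cases i <;> rfl

theorem form_two_swap (ω : Form g 2) (x y : g) : ω ![x, y] = -ω ![y, x] := by
  have h := ω.map_swap ![y, x] (i := 0) (j := 1) (by decide)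
  rw [← h]
  congr 1
  ext i
  fin_cases i <;> rfl

/-- A 2-form as a bilinear map. -/
def bilin (ω : Form g 2) : g →ₗ[ℝ] g →ₗ[ℝ] ℝ :=
  LinearMap.mk₂ ℝ (fun x y => ω ![x, y])
    (fun x x' y => ω.map_vecCons_add ![y] x x')
    (fun c x y => ω.map_vecCons_smul ![y] c x)
    (fun x y y' => by
      rw [form_two_swap ω x (y + y'), form_two_swap ω x y, form_two_swap ω x y',
        ω.map_vecCons_add ![x] y y', neg_add])
    (fun c x y => by
      rw [form_two_swap ω x (c • y), form_two_swap ω x y, ω.map_vecCons_smul ![x] c y, smul_neg])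

theorem bilin_apply (ω : Form g 2) (x y : g) : bilin ω x y = ω ![x, y] := rfl

theorem bilin_self (ω : Form g 2) (x : g) : bilin ω x x = 0 :=
  ω.map_eq_zero_of_eq ![x, x] (i := 0) (j := 1) rfl (by decide)

theorem bilin_swap (ω : Form g 2) (x y : g) : bilin ω x y = -bilin ω y x :=
  form_two_swap ω x y

/-- The differential `d : Λ¹(g*) → Λ²(g*)`, `dφ (u, v) = -φ [u, v]`. -/
def dOne : Module.Dual ℝ g →ₗ[ℝ] Form g 2 where
  toFun φ :=
    { toFun := fun v => -φ ⁅v 0, v 1⁆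
      map_update_add' := by
        intro _ m i x y
        fin_cases i <;> simp [Function.update] <;> ring
      map_update_smul' := by
        intro _ m i c x
        fin_cases i <;> simp [Function.update]
      map_eq_zero_of_eq' := by
        intro v i j h hij
        have h01 : v 0 = v 1 := by
          fin_cases i <;> fin_cases j <;> simp_all
        simp [h01] }
  map_add' a b := by ext v; simp; ring
  map_smul' c a := by ext v; simp

theorem dOne_apply (φ : Module.Dual ℝ g) (v : Fin 2 → g) : dOne φ v = -φ ⁅v 0, v 1⁆ := rfl

/-- The differential `d : Λ²(g*) → Λ³(g*)`,
`dω (x, y, z) = -ω ([x, y], z) + ω ([x, z], y) - ω ([y, z], x)`. -/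
def dTwo : Form g 2 →ₗ[ℝ] Form g 3 where
  toFun ω :=
    { toFun := fun v =>
        -ω ![⁅v 0, v 1⁆, v 2] + ω ![⁅v 0, v 2⁆, v 1] - ω ![⁅v 1, v 2⁆, v 0]
      map_update_add' := by
        intro inst m i x y
        obtain rfl : inst = instDecidableEqFin 3 := Subsingleton.elim _ _
        simp only [← bilin_apply]
        fin_cases i <;> simp [Function.update] <;> ring
      map_update_smul' := by
        intro inst m i c x
        obtain rfl : inst = instDecidableEqFin 3 := Subsingleton.elim _ _
        simp only [← bilin_apply]
        fin_cases i <;> simp [Function.update] <;> ring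
      map_eq_zero_of_eq' := by
        intro v i j h hij
        simp only [← bilin_apply]
        have h3 : v 0 = v 1 ∨ v 0 = v 2 ∨ v 1 = v 2 := by
          fin_cases i <;> fin_cases j <;> simp_all
        rcases h3 with h3 | h3 | h3
        · simp [h3]
        · rw [h3, ← lie_skew (v 2) (v 1), map_neg, LinearMap.neg_apply, lie_self, map_zero,
            LinearMap.zero_apply]
          ring
        · simp [h3] }
  map_add' a b := by ext v; simp; ring
  map_smul' c a := by ext v; simp; ring

theorem dTwo_apply (ω : Form g 2) (v : Fin 3 → g) :
    dTwo ω v = -ω ![⁅v 0, v 1⁆, v 2] + ω ![⁅v 0, v 2⁆, v 1] - ω ![⁅v 1, v 2⁆, v 0] := rfl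

variable (g) in
/-- The space of closed 2-forms. -/
def ClosedForm : Type _ := LinearMap.ker (dTwo (g := g))

instance : AddCommGroup (ClosedForm g) :=
  inferInstanceAs (AddCommGroup (LinearMap.ker (dTwo (g := g))))

instance : Module ℝ (ClosedForm g) :=
  inferInstanceAs (Module ℝ (LinearMap.ker (dTwo (g := g))))

/-- The inclusion of the closed 2-forms into all 2-forms. -/
def ClosedForm.form : ClosedForm g →ₗ[ℝ] Form g 2 :=
  (LinearMap.ker (dTwo (g := g))).subtype

theorem ClosedForm.form_injective : Function.Injective (ClosedForm.form (g := g)) :=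
  Subtype.val_injective

theorem ClosedForm.dTwo_form (ω : ClosedForm g) : dTwo ω.form = 0 :=
  LinearMap.mem_ker.mp ω.2

/-- A 2-form with vanishing differential, as a closed form. -/
def ClosedForm.mk (α : Form g 2) (hα : dTwo α = 0) : ClosedForm g := ⟨α, LinearMap.mem_ker.mpr hα⟩

theorem ClosedForm.form_mk (α : Form g 2) (hα : dTwo α = 0) : (ClosedForm.mk α hα).form = α := rfl

variable (g) in
/-- The exact 2-forms, as a subspace of the closed 2-forms. (Every exact form is closed, by the
Jacobi identity.) -/
def exactForms : Submodule ℝ (ClosedForm g) :=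
  (LinearMap.range (dOne (g := g))).comap ClosedForm.form

variable (g) in
/-- The second Chevalley-Eilenberg cohomology `H²(g)` with real coefficients. -/
abbrev H2 : Type _ := ClosedForm g ⧸ exactForms g

/-- `H²(g)` carries the module topology; for finite-dimensional `g` this is its unique Hausdorff
vector space topology. -/
instance H2.instTopologicalSpace : TopologicalSpace (H2 g) := moduleTopology ℝ (H2 g)

/-- The cohomology class `[ω]` of a closed 2-form. -/
def cls : ClosedForm g →ₗ[ℝ] H2 g := (exactForms g).mkQ

theorem dTwo_dOne (φ : Module.Dual ℝ g) : dTwo (dOne φ) = 0 := by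
  ext v
  simp only [dTwo_apply, dOne_apply, AlternatingMap.zero_apply, Matrix.cons_val_zero,
    Matrix.cons_val_one]
  have h := congrArg φ (lie_jacobi (v 0) (v 1) (v 2))
  simp only [map_add, map_zero] at h
  rw [← lie_skew (v 2) ⁅v 0, v 1⁆, ← lie_skew (v 1) ⁅v 2, v 0⁆, ← lie_skew (v 0) ⁅v 1, v 2⁆,
    ← lie_skew (v 2) (v 0)] at h
  simp only [map_neg, neg_lie] at h
  linarith

/-! ### The wedge product of 2-forms and the induced pairing on cohomology -/

/-- The wedge product of two 2-forms. -/
def wedge (α β : Form g 2) : Form g 4 :=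
  ((LinearMap.mul' ℝ ℝ).compAlternatingMap (α.domCoprod β)).domDomCongr
    (finSumFinEquiv (m := 2) (n := 2))

theorem sum_perm_four (F : Fin 4 → Fin 4 → Fin 4 → Fin 4 → ℝ) :
   ∑ σ : Equiv.Perm (Fin 4), ((Equiv.Perm.sign σ : ℤ) : ℝ) * F (σ 0) (σ 1) (σ 2) (σ 3) = 
    F 0 1 2 3 - F 0 1 3 2 - F 0 2 1 3 + F 0 2 3 1 + F 0 3 1 2 - F 0 3 2 1
    - F 1 0 2 3 + F 1 0 3 2 + F 1 2 0 3 - F 1 2 3 0 - F 1 3 0 2 + F 1 3 2 0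
    + F 2 0 1 3 - F 2 0 3 1 - F 2 1 0 3 + F 2 1 3 0 + F 2 3 0 1 - F 2 3 1 0
    - F 3 0 1 2 + F 3 0 2 1 + F 3 1 0 2 - F 3 1 2 0 - F 3 2 0 1 + F 3 2 1 0 := by
  have e : (Finset.univ : Finset (Equiv.Perm (Fin 4))).val.map (fun σ => ((Equiv.Perm.sign σ : ℤ), σ 0, σ 1, σ 2, σ 3)) =
   ([((1), 0, 1, 2, 3),
  ((-1), 0, 1, 3, 2),
  ((-1), 0, 2, 1, 3),
  ((1), 0, 2, 3, 1),
  ((-1), 0, 3, 2, 1),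
  ((1), 0, 3, 1, 2),
  ((-1), 1, 0, 2, 3),
  ((1), 1, 0, 3, 2),
  ((1), 1, 2, 0, 3),
  ((-1), 1, 2, 3, 0),
  ((1), 1, 3, 2, 0),
  ((-1), 1, 3, 0, 2),
  ((-1), 2, 1, 0, 3),
  ((1), 2, 1, 3, 0),
  ((1), 2, 0, 1, 3),
  ((-1), 2, 0, 3, 1),
  ((1), 2, 3, 0, 1),
  ((-1), 2, 3, 1, 0),
  ((-1), 3, 1, 2, 0),
  ((1), 3, 1, 0, 2),
  ((1), 3, 2, 1, 0),
  ((-1), 3, 2, 0, 1),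
  ((1), 3, 0, 2, 1),
  ((-1), 3, 0, 1, 2)
 ] : List (ℤ × Fin 4 × Fin 4 × Fin 4 × Fin 4)) := by decide
  have := congrArg (fun m => (m.map (fun t : ℤ × Fin 4 × Fin 4 × Fin 4 × Fin 4 => (t.1 : ℝ) * F t.2.1 t.2.2.1 t.2.2.2.1 t.2.2.2.2)).sum) e
  simp only [Multiset.map_map, Function.comp_def, Multiset.map_coe, Multiset.sum_coe, List.map_cons, List.map_nil, List.sum_cons, List.sum_nil] at this
  rw [Finset.sum, this]
  push_cast
  ring


theorem wedge_apply (α β : Form g 2) (v : Fin 4 → g) :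
    wedge α β v =
      α ![v 0, v 1] * β ![v 2, v 3] - α ![v 0, v 2] * β ![v 1, v 3]
      + α ![v 0, v 3] * β ![v 1, v 2] + α ![v 1, v 2] * β ![v 0, v 3]
      - α ![v 1, v 3] * β ![v 0, v 2] + α ![v 2, v 3] * β ![v 0, v 1] := by
  have key := MultilinearMap.domCoprod_alternization_eq α β
  have k2 := congrArg
    (fun f => LinearMap.mul' ℝ ℝ (f (v ∘ (finSumFinEquiv (m := 2) (n := 2))))) key
  have hw : wedge α β v = (LinearMap.mul' ℝ ℝ)
      (α.domCoprod β (v ∘ (finSumFinEquiv (m := 2) (n := 2)))) := rfl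
  rw [hw]
  simp only [MultilinearMap.alternatization_apply, Fintype.card_fin, AlternatingMap.smul_apply,
    map_nsmul, map_sum] at k2
  rw [← Equiv.sum_comp ((finSumFinEquiv (m := 2) (n := 2)).symm.permCongr)] at k2
  have h := sum_perm_four
    (fun i j k l => α ![v i, v j] * β ![v k, v l])
  have h2 : ∀ σ : Equiv.Perm (Fin 4), (LinearMap.mul' ℝ ℝ)
      (Equiv.Perm.sign ((finSumFinEquiv (m := 2) (n := 2)).symm.permCongr σ) •
        (MultilinearMap.domDomCongr ((finSumFinEquiv (m := 2) (n := 2)).symm.permCongr σ)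
          (MultilinearMap.domCoprod (α : MultilinearMap ℝ (fun _ : Fin 2 => g) ℝ)
            (β : MultilinearMap ℝ (fun _ : Fin 2 => g) ℝ)))
        (v ∘ (finSumFinEquiv (m := 2) (n := 2)))) =
      ((Equiv.Perm.sign σ : ℤ) : ℝ) *
        (α ![v (σ 0), v (σ 1)] * β ![v (σ 2), v (σ 3)]) := by
    intro σ
    rw [Equiv.Perm.sign_permCongr]
    rcases Int.units_eq_one_or (Equiv.Perm.sign σ) with hσ | hσ <;>
      simp [hσ, form_two_apply α (fun _ => _), form_two_apply β (fun _ => _),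
        Equiv.permCongr_apply] <;> rfl
  rw [Finset.sum_congr rfl (fun σ _ => h2 σ), h] at k2
  rw [nsmul_eq_mul] at k2
  have h4 : (((Nat.factorial 2 * Nat.factorial 2 : ℕ)) : ℝ) = 4 := by norm_num [Nat.factorial]
  rw [h4] at k2
  have s := form_two_swap (g := g)
  rw [s α (v 1) (v 0), s α (v 2) (v 0), s α (v 3) (v 0), s α (v 2) (v 1), s α (v 3) (v 1),
    s α (v 3) (v 2), s β (v 1) (v 0), s β (v 2) (v 0), s β (v 3) (v 0), s β (v 2) (v 1),
    s β (v 3) (v 1), s β (v 3) (v 2)] at k2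
  linarith

theorem wedge_comm (α β : Form g 2) : wedge α β = wedge β α := by
  ext v
  simp only [wedge_apply]
  ring

/-- The pairing `Φ_ζ (α, β) = (α ∧ β)(ζ)` on 2-forms, for a 4-vector `ζ ∈ Λ⁴(g)`. -/
def wedgePairing (ζ : ⋀[ℝ]^4 g) : Form g 2 →ₗ[ℝ] Form g 2 →ₗ[ℝ] ℝ :=
  LinearMap.mk₂ ℝ (fun α β => exteriorPower.alternatingMapLinearEquiv (wedge α β) ζ)
    (fun α α' β => by
      have : wedge (α + α') β = wedge α β + wedge α' β := by
        ext v; simp [wedge_apply]; ring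
      rw [this, map_add, LinearMap.add_apply])
    (fun c α β => by
      have : wedge (c • α) β = c • wedge α β := by
        ext v; simp [wedge_apply]; ring
      rw [this, map_smul, LinearMap.smul_apply])
    (fun α β β' => by
      have : wedge α (β + β') = wedge α β + wedge α β' := by
        ext v; simp [wedge_apply]; ring
      rw [this, map_add, LinearMap.add_apply])
    (fun c α β => by
      have : wedge α (c • β) = c • wedge α β := by
        ext v; simp [wedge_apply]; ring
      rw [this, map_smul, LinearMap.smul_apply])

theorem wedgePairing_apply (ζ : ⋀[ℝ]^4 g) (α β : Form g 2) :
    wedgePairing ζ α β = exteriorPower.alternatingMapLinearEquiv (wedge α β) ζ := rfl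

/-- On a 4-dimensional unimodular Lie algebra, closed 2-forms wedge trivially with exact ones. -/
theorem wedge_exact_eq_zero (h4 : Module.finrank ℝ g = 4) (hu : IsUnimodular g)
    {α : Form g 2} (hα : dTwo α = 0) (φ : Module.Dual ℝ g) : wedge α (dOne φ) = 0 := by
  have : Module.Finite ℝ g := Module.finite_of_finrank_eq_succ h4
  let b : Module.Basis (Fin 4) ℝ g := Module.finBasisOfFinrankEq ℝ g h4
  refine (AlternatingMap.map_basis_eq_zero_iff b (wedge α (dOne φ))).mp ?_
  obtain ⟨c, hc⟩ : ∃ c : Fin 4 → Fin 4 → Fin 4 → ℝ, ∀ i j k, c i j k = b.repr ⁅b i, b j⁆ k :=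
    ⟨_, fun _ _ _ => rfl⟩
  have hbr : ∀ i j, ⁅b i, b j⁆ =
      c i j 0 • b 0 + c i j 1 • b 1 + c i j 2 • b 2 + c i j 3 • b 3 := by
    intro i j
    rw [hc, hc, hc, hc, ← Fin.sum_univ_four (fun k => b.repr ⁅b i, b j⁆ k • b k), b.sum_repr]
  have hcs : ∀ i j k, c i j k = -c j i k := by
    intro i j k
    rw [hc, hc, ← lie_skew (b i) (b j), map_neg, Finsupp.neg_apply]
  have hcz : ∀ i k, c i i k = 0 := by
    intro i k
    rw [hc]
    simp
  have htr : ∀ i, c i 0 0 + c i 1 1 + c i 2 2 + c i 3 3 = 0 := by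
    intro i
    have h := hu (b i)
    rw [LinearMap.trace_eq_matrix_trace ℝ b, Matrix.trace, Fin.sum_univ_four] at h
    simpa [Matrix.diag, LinearMap.toMatrix_apply, hc] using h
  have hcl : ∀ i j k, -bilin α ⁅b i, b j⁆ (b k) + bilin α ⁅b i, b k⁆ (b j)
      - bilin α ⁅b j, b k⁆ (b i) = 0 := by
    intro i j k
    have h := congrArg (fun f : Form g 3 => f ![b i, b j, b k]) hα
    simpa [dTwo_apply, bilin_apply] using h
  have h012 := hcl 0 1 2
  have h013 := hcl 0 1 3
  have h023 := hcl 0 2 3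
  have h123 := hcl 1 2 3
  have t0 := htr 0
  have t1 := htr 1
  have t2 := htr 2
  have t3 := htr 3
  have hd : ∀ i j, (dOne φ) ![b i, b j] =
      -(c i j 0 * φ (b 0) + c i j 1 * φ (b 1) + c i j 2 * φ (b 2) + c i j 3 * φ (b 3)) := by
    intro i j
    simp [dOne_apply, hbr i j]
  rw [wedge_apply]
  simp only [hd]
  clear hd htr hc
  clear_value b
  simp only [← bilin_apply]
  simp only [hbr, map_add, map_smul, LinearMap.add_apply, LinearMap.smul_apply, smul_eq_mul,
    bilin_self, bilin_swap α (b 1) (b 0), bilin_swap α (b 2) (b 0), bilin_swap α (b 3) (b 0),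
    bilin_swap α (b 2) (b 1), bilin_swap α (b 3) (b 1), bilin_swap α (b 3) (b 2)]
    at h012 h013 h023 h123 ⊢
  simp only [hcs 1 0, hcs 2 0, hcs 3 0, hcs 2 1, hcs 3 1, hcs 3 2, hcz] at t0 t1 t2 t3
  linear_combination (-1 : ℝ) * (φ (b 3) * h012 - φ (b 2) * h013 + φ (b 1) * h023 - φ (b 0) * h123)
    + (-1 : ℝ) * (t0 * (bilin α (b 1) (b 2) * φ (b 3) - bilin α (b 1) (b 3) * φ (b 2)
        + bilin α (b 2) (b 3) * φ (b 1))
      - t1 * (bilin α (b 0) (b 2) * φ (b 3) - bilin α (b 0) (b 3) * φ (b 2)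
        + bilin α (b 2) (b 3) * φ (b 0))
      + t2 * (bilin α (b 0) (b 1) * φ (b 3) - bilin α (b 0) (b 3) * φ (b 1)
        + bilin α (b 1) (b 3) * φ (b 0))
      - t3 * (bilin α (b 0) (b 1) * φ (b 2) - bilin α (b 0) (b 2) * φ (b 1)
        + bilin α (b 1) (b 2) * φ (b 0)))

theorem wedgePairing_exact_right (h4 : Module.finrank ℝ g = 4) (hu : IsUnimodular g)
    (ζ : ⋀[ℝ]^4 g) (α β : ClosedForm g) (hβ : β ∈ exactForms g) :
    wedgePairing ζ α.form β.form = 0 := by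
  obtain ⟨φ, hφ⟩ := hβ
  rw [wedgePairing_apply, show β.form = dOne φ from hφ.symm,
    wedge_exact_eq_zero h4 hu α.dTwo_form φ, map_zero, LinearMap.zero_apply]

/-- The pairing on `H²(g)` induced by `Φ_ζ`; it is well defined on a 4-dimensional unimodular Lie
algebra. -/
def cohomologyPairing (h4 : Module.finrank ℝ g = 4) (hu : IsUnimodular g) (ζ : ⋀[ℝ]^4 g) :
    H2 g →ₗ[ℝ] H2 g →ₗ[ℝ] ℝ :=
  (exactForms g).liftQ
    (LinearMap.flip ((exactForms g).liftQ
      (LinearMap.flip ((wedgePairing ζ).compl₁₂ ClosedForm.form ClosedForm.form))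
      (fun β hβ => by
        ext α
        exact wedgePairing_exact_right h4 hu ζ α β hβ)))
    (fun α hα => by
      ext β
      change wedgePairing ζ α.form β.form = 0
      rw [wedgePairing_apply, wedge_comm, ← wedgePairing_apply]
      exact wedgePairing_exact_right h4 hu ζ β α hα)

theorem cohomologyPairing_cls (h4 : Module.finrank ℝ g = 4) (hu : IsUnimodular g)
    (ζ : ⋀[ℝ]^4 g) (α β : ClosedForm g) :
    cohomologyPairing h4 hu ζ (cls α) (cls β) = wedgePairing ζ α.form β.form := rfl

/-! ### Almost complex structures, tamed and compatible forms, and their cones -/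

/-- A 4-vector induces the natural orientation of `(g, J)` if it is nonzero and of the form
`v ∧ Jv ∧ w ∧ Jw`. On a 4-dimensional space these 4-vectors form exactly one of the two rays of
`Λ⁴(g) ∖ {0}`. -/
def InducesOrientation (J : g →ₗ[ℝ] g) (ζ : ⋀[ℝ]^4 g) : Prop :=
  ζ ≠ 0 ∧ ∃ v w : g, ζ = exteriorPower.ιMulti ℝ 4 ![v, J v, w, J w]

/-- The `J`-invariant 2-forms `Λ_J⁺(g*)`. -/
def invariantForms (J : g →ₗ[ℝ] g) : Submodule ℝ (Form g 2) where
  carrier := {α | ∀ x y : g, α ![J x, J y] = α ![x, y]}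
  add_mem' ha hb x y := by simp [ha x y, hb x y]
  zero_mem' x y := by simp
  smul_mem' c a ha x y := by simp [ha x y]

/-- The `J`-anti-invariant 2-forms `Λ_J⁻(g*)`. -/
def antiInvariantForms (J : g →ₗ[ℝ] g) : Submodule ℝ (Form g 2) where
  carrier := {α | ∀ x y : g, α ![J x, J y] = -α ![x, y]}
  add_mem' ha hb x y := by simp [ha x y, hb x y]; ring
  zero_mem' x y := by simp
  smul_mem' c a ha x y := by simp [ha x y]

/-- `H_J⁺(g)`: the classes represented by closed `J`-invariant 2-forms. -/
def HPlus (J : g →ₗ[ℝ] g) : Submodule ℝ (H2 g) :=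
  ((invariantForms J).comap ClosedForm.form).map cls

/-- `H_J⁻(g)`: the classes represented by closed `J`-anti-invariant 2-forms. -/
def HMinus (J : g →ₗ[ℝ] g) : Submodule ℝ (H2 g) :=
  ((antiInvariantForms J).comap ClosedForm.form).map cls

/-- A closed 2-form is `J`-tamed if it is positive on `v ∧ Jv` for every nonzero `v`. -/
def IsTamedForm (J : g →ₗ[ℝ] g) (ω : ClosedForm g) : Prop :=
  ∀ v : g, v ≠ 0 → 0 < ω.form ![v, J v]

/-- A `J`-tamed closed 2-form is `J`-compatible if it is moreover `J`-invariant. -/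
def IsCompatibleForm (J : g →ₗ[ℝ] g) (ω : ClosedForm g) : Prop :=
  IsTamedForm J ω ∧ ω.form ∈ invariantForms J

/-- `J` is tamed if there is a `J`-tamed closed 2-form. -/
def IsTamed (J : g →ₗ[ℝ] g) : Prop :=
  ∃ ω : ClosedForm g, IsTamedForm J ω

/-- The `J`-tamed cone `K_J^t`. -/
def tamedCone (J : g →ₗ[ℝ] g) : Set (H2 g) :=
  {e | ∃ ω : ClosedForm g, IsTamedForm J ω ∧ cls ω = e}

/-- The `J`-compatible cone `K_J^c`. -/
def compatibleCone (J : g →ₗ[ℝ] g) : Set (H2 g) :=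
  {e | e ∈ HPlus J ∧ ∃ ω : ClosedForm g, IsCompatibleForm J ω ∧ cls ω = e}

/-- The set `P_J = {e ∈ H_J⁺(g) | e² > 0}`, where `e² = Φ_ζ (e, e)`. -/
def positiveClasses (h4 : Module.finrank ℝ g = 4) (hu : IsUnimodular g) (ζ : ⋀[ℝ]^4 g)
    (J : g →ₗ[ℝ] g) : Set (H2 g) :=
  {e | e ∈ HPlus J ∧ 0 < cohomologyPairing h4 hu ζ e e}

end LieACS

end

noncomputable section

namespace LieACS

variable {g : Type*} [LieRing g] [LieAlgebra ℝ g]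

/-! The wedge pairing splits orthogonally over the type decomposition of 2-forms. On invariant forms
it is the polarised determinant of Hermitian `2 × 2` matrices, of signature (1,3), and the tamed
invariant forms are one half of its timelike cone (`invariant_tamed_iff`). On anti-invariant forms
it is positive definite, and these forms vanish on every pair `v, J v`.

Unimodularity makes the closed 2-forms exactly the orthogonal complement of the exact ones
(`wedge_exact_eq_zero`, `dTwo_eq_zero_of_orthogonal`). Exact forms are therefore isotropic, so their
invariant parts have nonpositive square. A tamed form has timelike invariant part, which makes these
invariant parts negative definite (`exact_eq_zero_of_invariantPart_null`). Hence any 2-form can be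
shifted by an exact form until its invariant part is orthogonal to all exact forms, that is, closed
(`exists_exact_add_closed_parts`). For a tamed form the projection only increases the square and
stays in the same half cone, so the new invariant part is compatible and the remainder is closed and
anti-invariant. This gives the tamed cone.

For a compatible `F`, the hyperplane orthogonal to `[F]` misses the positive classes, and the
compatible cone is the part of them on the side of `[F]`. It is convex, hence a whole component. -/

/-! ### Lorentzian inequalities for Hermitian `2 × 2` matrices -/

/-- A positive definite Hermitian matrix is timelike, and a matrix orthogonal to it is spacelike. -/
theorem hermitian_spacelike {a c p q a' c' p' q' : ℝ} (ha' : 0 < a')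
    (hd' : 0 < a' * c' - p' ^ 2 - q' ^ 2)
    (horth : a * c' + c * a' - 2 * p * p' - 2 * q * q' = 0)
    (hd : 0 ≤ a * c - p ^ 2 - q ^ 2) : a = 0 ∧ c = 0 ∧ p = 0 ∧ q = 0 := by
  have hc' : 0 < c' := by
    by_contra! h
    nlinarith [mul_nonneg ha'.le (neg_nonneg.mpr h), sq_nonneg p', sq_nonneg q']
  -- By orthogonality, `4 * (a * c) * (a' * c') ≤ (a * c' + c * a') ^ 2 = 4 * (p * p' + q * q') ^
  -- 2`. The left side is at least `4 * (a' * c') * (p ^ 2 + q ^ 2)`, and Cauchy–Schwarz bounds the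
  -- right.
  have hpq : (p ^ 2 + q ^ 2) * (a' * c' - p' ^ 2 - q' ^ 2) ≤ 0 := by
    have h1 : 0 ≤ (a' * c') * (a * c - p ^ 2 - q ^ 2) := mul_nonneg (mul_pos ha' hc').le hd
    have h2 : (a * c' + c * a') ^ 2 = (2 * p * p' + 2 * q * q') ^ 2 := by
      congr 1; linarith
    nlinarith [sq_nonneg (a * c' - c * a'), sq_nonneg (p * q' - q * p')]
  have hs : p ^ 2 + q ^ 2 = 0 := by
    have : 0 ≤ p ^ 2 + q ^ 2 := by positivity
    by_contra h
    exact absurd (mul_pos (lt_of_le_of_ne this (Ne.symm h)) hd') (not_lt.mpr hpq)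
  obtain rfl : p = 0 := by nlinarith [sq_nonneg p, sq_nonneg q]
  obtain rfl : q = 0 := by nlinarith [sq_nonneg q]
  have hac : a * c' = -(c * a') := by linarith
  have ha : a = 0 := by
    have h1 : a ^ 2 * c' = -(a * c * a') := by linear_combination a * hac
    have h2 : 0 ≤ a * c * a' := mul_nonneg (by linarith) ha'.le
    have h3 : 0 ≤ a ^ 2 * c' := by positivity
    have h4 : a ^ 2 * c' = 0 := by linarith
    simpa [hc'.ne'] using h4
  subst ha
  have : c * a' = 0 := by linarith
  exact ⟨rfl, by simpa [ha'.ne'] using this, rfl, rfl⟩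

/-- Reverse Cauchy–Schwarz: after multiplication by `a * a'` the pairing is a positive combination
of the two determinants plus squares. -/
theorem hermitian_pairing_pos {a c p q a' c' p' q' : ℝ} (ha' : 0 < a')
    (hd' : 0 < a' * c' - p' ^ 2 - q' ^ 2) (ha : 0 < a) (hd : 0 < a * c - p ^ 2 - q ^ 2) :
    0 < a * c' + c * a' - 2 * p * p' - 2 * q * q' := by
  have key : a * a' * (a * c' + c * a' - 2 * p * p' - 2 * q * q') =
      a ^ 2 * (a' * c' - p' ^ 2 - q' ^ 2) + a' ^ 2 * (a * c - p ^ 2 - q ^ 2)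
        + (a * p' - a' * p) ^ 2 + (a * q' - a' * q) ^ 2 := by ring
  have : 0 < a * a' * (a * c' + c * a' - 2 * p * p' - 2 * q * q') := by rw [key]; positivity
  exact (mul_pos_iff_of_pos_left (mul_pos ha ha')).mp this

/-- A timelike matrix with `a < 0` lies in the opposite half cone, where its negative pairs
positively; `a = 0` is excluded by the determinant. -/
theorem hermitian_pos_of_pairing_pos {a c p q a' c' p' q' : ℝ} (ha' : 0 < a')
    (hd' : 0 < a' * c' - p' ^ 2 - q' ^ 2) (hd : 0 < a * c - p ^ 2 - q ^ 2)
    (h : 0 < a * c' + c * a' - 2 * p * p' - 2 * q * q') : 0 < a := by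
  by_contra! ha
  rcases ha.lt_or_eq with ha | rfl
  · have := hermitian_pairing_pos (a := -a) (c := -c) (p := -p) (q := -q) ha' hd' (by linarith)
      (by linarith)
    linarith
  · nlinarith [sq_nonneg p, sq_nonneg q]

/-! ### Orthogonal projection onto an anisotropic subspace -/

/-- Anisotropy makes `V → V*` injective, hence surjective in finite dimension, so `B v = -B x` on
`V` is solvable. No finiteness of `M` and no symmetry of `B` enter. -/
theorem exists_add_orthogonal_of_anisotropic {M : Type*} [AddCommGroup M] [Module ℝ M]
    (B : M →ₗ[ℝ] M →ₗ[ℝ] ℝ) (V : Submodule ℝ M) [Module.Finite ℝ V]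
    (hV : ∀ v ∈ V, B v v = 0 → v = 0) (x : M) :
    ∃ v ∈ V, ∀ w ∈ V, B (x + v) w = 0 := by
  let L : V →ₗ[ℝ] Module.Dual ℝ V := B.compl₁₂ V.subtype V.subtype
  have hinj : Function.Injective L := by
    rw [← LinearMap.ker_eq_bot, LinearMap.ker_eq_bot']
    intro v hv
    exact Subtype.ext (hV v v.2 (LinearMap.congr_fun hv v))
  obtain ⟨v, hv⟩ := (LinearMap.injective_iff_surjective_of_finrank_eq_finrank
    (Subspace.dual_finrank_eq (K := ℝ) (V := V)).symm).mp hinj (-(B x ∘ₗ V.subtype))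
  refine ⟨v, v.2, fun w hw => ?_⟩
  have := LinearMap.congr_fun hv ⟨w, hw⟩
  have h' : B v w = -B x w := this
  simp [h']

/-! ### The invariant part of a 2-form -/

/-- The `J`-invariant part `(α + α(J·, J·)) / 2` of a 2-form. -/
def invariantPart (J : g →ₗ[ℝ] g) : Form g 2 →ₗ[ℝ] Form g 2 where
  toFun α := (1 / 2 : ℝ) • (α + α.compLinearMap J)
  map_add' α β := by ext v; simp; ring
  map_smul' c α := by ext v; simp; ring

theorem invariantPart_apply (J : g →ₗ[ℝ] g) (α : Form g 2) (x y : g) :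
    invariantPart J α ![x, y] = (α ![x, y] + α ![J x, J y]) / 2 := by
  have h : (fun i => J (![x, y] i)) = ![J x, J y] := by
    ext i; fin_cases i <;> rfl
  simp [invariantPart, h, AlternatingMap.compLinearMap_apply]
  ring

theorem form_two_neg_neg (α : Form g 2) (x y : g) : α ![-x, -y] = α ![x, y] := by
  simp [← bilin_apply]

theorem form_two_neg_right (α : Form g 2) (x y : g) : α ![x, -y] = -α ![x, y] := by
  simp [← bilin_apply]

theorem form_two_neg_left (α : Form g 2) (x y : g) : α ![-x, y] = -α ![x, y] := by
  simp [← bilin_apply]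

theorem form_two_ext {α β : Form g 2} (h : ∀ x y, α ![x, y] = β ![x, y]) : α = β := by
  ext v
  rw [form_two_apply α, form_two_apply β, h]

theorem invariantPart_mem {J : g →ₗ[ℝ] g} (hJ : IsAlmostComplex J) (α : Form g 2) :
    invariantPart J α ∈ invariantForms J := by
  intro x y
  rw [invariantPart_apply, invariantPart_apply, hJ, hJ, form_two_neg_neg, add_comm]

theorem sub_invariantPart_mem {J : g →ₗ[ℝ] g} (hJ : IsAlmostComplex J) (α : Form g 2) :
    α - invariantPart J α ∈ antiInvariantForms J := by
  intro x y
  simp only [AlternatingMap.sub_apply]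
  rw [invariantPart_apply, invariantPart_apply, hJ, hJ, form_two_neg_neg]
  ring

/-- This is why tamedness sees only the invariant part of a form. -/
theorem antiInvariant_apply_self {J : g →ₗ[ℝ] g} (hJ : IsAlmostComplex J) {α : Form g 2}
    (hα : α ∈ antiInvariantForms J) (x : g) : α ![x, J x] = 0 := by
  have h := hα x (J x)
  rw [hJ, form_two_neg_right, form_two_swap α (J x) x] at h
  linarith

theorem invariantPart_apply_self {J : g →ₗ[ℝ] g} (hJ : IsAlmostComplex J) (α : Form g 2) (x : g) :
    invariantPart J α ![x, J x] = α ![x, J x] := by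
  have h := antiInvariant_apply_self hJ (sub_invariantPart_mem hJ α) x
  simp only [AlternatingMap.sub_apply] at h
  linarith

/-! ### Adapted bases -/

/-- A basis of the form `v, J v, w, J w`. -/
structure IsAdaptedBasis (J : g →ₗ[ℝ] g) (b : Module.Basis (Fin 4) ℝ g) : Prop where
  one : J (b 0) = b 1
  three : J (b 2) = b 3

/-- The 4-vector `b₀ ∧ b₁ ∧ b₂ ∧ b₃` of a basis. -/
def topVector (b : Module.Basis (Fin 4) ℝ g) : ⋀[ℝ]^4 g := exteriorPower.ιMulti ℝ 4 b

theorem wedgePairing_topVector (b : Module.Basis (Fin 4) ℝ g) (α β : Form g 2) :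
    wedgePairing (topVector b) α β =
      α ![b 0, b 1] * β ![b 2, b 3] - α ![b 0, b 2] * β ![b 1, b 3]
      + α ![b 0, b 3] * β ![b 1, b 2] + α ![b 1, b 2] * β ![b 0, b 3]
      - α ![b 1, b 3] * β ![b 0, b 2] + α ![b 2, b 3] * β ![b 0, b 1] := by
  rw [wedgePairing_apply, topVector, exteriorPower.alternatingMapLinearEquiv_apply_ιMulti,
    wedge_apply]

theorem wedgePairing_comm (ζ : ⋀[ℝ]^4 g) (α β : Form g 2) :
    wedgePairing ζ α β = wedgePairing ζ β α := by
  rw [wedgePairing_apply, wedge_comm, ← wedgePairing_apply]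

theorem form_eq_zero_of_basis (b : Module.Basis (Fin 4) ℝ g) {α : Form g 2}
    (h01 : α ![b 0, b 1] = 0) (h02 : α ![b 0, b 2] = 0) (h03 : α ![b 0, b 3] = 0)
    (h12 : α ![b 1, b 2] = 0) (h13 : α ![b 1, b 3] = 0) (h23 : α ![b 2, b 3] = 0) : α = 0 := by
  have h : bilin α = 0 := by
    refine b.ext fun i => b.ext fun j => ?_
    have s := fun i j => bilin_swap α (b i) (b j)
    simp only [← bilin_apply] at *
    fin_cases i <;> fin_cases j <;>
      simp [bilin_self, h01, h02, h03, h12, h13, h23, s 1 0, s 2 0, s 3 0, s 2 1, s 3 1, s 3 2]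
  refine form_two_ext fun x y => ?_
  rw [← bilin_apply, h]
  rfl

section Adapted

variable {J : g →ₗ[ℝ] g} {b : Module.Basis (Fin 4) ℝ g}

theorem IsAdaptedBasis.J_one (hb : IsAdaptedBasis J b) (hJ : IsAlmostComplex J) :
    J (b 1) = -b 0 := by rw [← hb.one, hJ]

theorem IsAdaptedBasis.J_three (hb : IsAdaptedBasis J b) (hJ : IsAlmostComplex J) :
    J (b 3) = -b 2 := by rw [← hb.three, hJ]

theorem IsAdaptedBasis.invariant_one_three (hb : IsAdaptedBasis J b) {α : Form g 2}
    (hα : α ∈ invariantForms J) : α ![b 1, b 3] = α ![b 0, b 2] := by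
  rw [← hb.one, ← hb.three, hα]

theorem IsAdaptedBasis.invariant_one_two (hb : IsAdaptedBasis J b) (hJ : IsAlmostComplex J)
    {α : Form g 2} (hα : α ∈ invariantForms J) : α ![b 1, b 2] = -α ![b 0, b 3] := by
  rw [← hα (b 1) (b 2), hb.J_one hJ, hb.three, form_two_neg_left]

theorem IsAdaptedBasis.antiInvariant_one_three (hb : IsAdaptedBasis J b) {α : Form g 2}
    (hα : α ∈ antiInvariantForms J) : α ![b 1, b 3] = -α ![b 0, b 2] := by
  rw [← hb.one, ← hb.three, hα]

theorem IsAdaptedBasis.antiInvariant_one_two (hb : IsAdaptedBasis J b) (hJ : IsAlmostComplex J)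
    {α : Form g 2} (hα : α ∈ antiInvariantForms J) : α ![b 1, b 2] = α ![b 0, b 3] := by
  have h := hα (b 1) (b 2)
  rw [hb.J_one hJ, hb.three, form_two_neg_left] at h
  linarith

theorem IsAdaptedBasis.antiInvariant_zero_one (hb : IsAdaptedBasis J b) (hJ : IsAlmostComplex J)
    {α : Form g 2} (hα : α ∈ antiInvariantForms J) : α ![b 0, b 1] = 0 := by
  rw [← hb.one, antiInvariant_apply_self hJ hα]

theorem IsAdaptedBasis.antiInvariant_two_three (hb : IsAdaptedBasis J b) (hJ : IsAlmostComplex J)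
    {α : Form g 2} (hα : α ∈ antiInvariantForms J) : α ![b 2, b 3] = 0 := by
  rw [← hb.three, antiInvariant_apply_self hJ hα]

/-- With `a, c, p, q` the values on `(b 0, b 1)`, `(b 2, b 3)`, `(b 0, b 2)`, `(b 0, b 3)`, this is
the expression in the Hermitian matrix lemmas. -/
theorem wedgePairing_invariant (hb : IsAdaptedBasis J b) (hJ : IsAlmostComplex J)
    {α β : Form g 2} (hα : α ∈ invariantForms J) (hβ : β ∈ invariantForms J) :
    wedgePairing (topVector b) α β =
      α ![b 0, b 1] * β ![b 2, b 3] + α ![b 2, b 3] * β ![b 0, b 1]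
        - 2 * α ![b 0, b 2] * β ![b 0, b 2] - 2 * α ![b 0, b 3] * β ![b 0, b 3] := by
  rw [wedgePairing_topVector, hb.invariant_one_three hα, hb.invariant_one_three hβ,
    hb.invariant_one_two hJ hα, hb.invariant_one_two hJ hβ]
  ring

theorem wedgePairing_invariant_self (hb : IsAdaptedBasis J b) (hJ : IsAlmostComplex J)
    {α : Form g 2} (hα : α ∈ invariantForms J) :
    wedgePairing (topVector b) α α =
      2 * (α ![b 0, b 1] * α ![b 2, b 3] - α ![b 0, b 2] ^ 2 - α ![b 0, b 3] ^ 2) := by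
  rw [wedgePairing_invariant hb hJ hα hα]
  ring

theorem wedgePairing_invariant_antiInvariant (hb : IsAdaptedBasis J b) (hJ : IsAlmostComplex J)
    {α β : Form g 2} (hα : α ∈ invariantForms J) (hβ : β ∈ antiInvariantForms J) :
    wedgePairing (topVector b) α β = 0 := by
  rw [wedgePairing_topVector, hb.invariant_one_three hα, hb.antiInvariant_one_three hβ,
    hb.invariant_one_two hJ hα, hb.antiInvariant_one_two hJ hβ, hb.antiInvariant_zero_one hJ hβ,
    hb.antiInvariant_two_three hJ hβ]
  ring

theorem wedgePairing_antiInvariant_self (hb : IsAdaptedBasis J b) (hJ : IsAlmostComplex J)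
    {α : Form g 2} (hα : α ∈ antiInvariantForms J) :
    wedgePairing (topVector b) α α = 2 * (α ![b 0, b 2] ^ 2 + α ![b 0, b 3] ^ 2) := by
  rw [wedgePairing_topVector, hb.antiInvariant_one_three hα,
    hb.antiInvariant_one_two hJ hα, hb.antiInvariant_zero_one hJ hα]
  ring

theorem antiInvariant_eq_zero_of_self (hb : IsAdaptedBasis J b) (hJ : IsAlmostComplex J)
    {α : Form g 2} (hα : α ∈ antiInvariantForms J)
    (h : wedgePairing (topVector b) α α = 0) : α = 0 := by
  rw [wedgePairing_antiInvariant_self hb hJ hα] at h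
  have h2 : α ![b 0, b 2] = 0 := by nlinarith [sq_nonneg (α ![b 0, b 2]), sq_nonneg (α ![b 0, b 3])]
  have h3 : α ![b 0, b 3] = 0 := by nlinarith [sq_nonneg (α ![b 0, b 2]), sq_nonneg (α ![b 0, b 3])]
  exact form_eq_zero_of_basis b (hb.antiInvariant_zero_one hJ hα) h2 h3
    (by rw [hb.antiInvariant_one_two hJ hα, h3])
    (by rw [hb.antiInvariant_one_three hα, h2, neg_zero]) (hb.antiInvariant_two_three hJ hα)

/-- The Hermitian form of an invariant 2-form in an adapted basis. -/
theorem invariant_apply_self_coords (hb : IsAdaptedBasis J b) (hJ : IsAlmostComplex J)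
    {α : Form g 2} (hα : α ∈ invariantForms J) (x₀ x₁ x₂ x₃ : ℝ) :
    α ![x₀ • b 0 + x₁ • b 1 + x₂ • b 2 + x₃ • b 3,
      J (x₀ • b 0 + x₁ • b 1 + x₂ • b 2 + x₃ • b 3)] =
      α ![b 0, b 1] * (x₀ ^ 2 + x₁ ^ 2) + α ![b 2, b 3] * (x₂ ^ 2 + x₃ ^ 2)
        + 2 * α ![b 0, b 3] * (x₀ * x₂ + x₁ * x₃) + 2 * α ![b 0, b 2] * (x₁ * x₂ - x₀ * x₃) := by
  have h13 := hb.invariant_one_three hα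
  have h12 := hb.invariant_one_two hJ hα
  simp only [← bilin_apply, map_add, map_smul, hb.one, hb.three, hb.J_one hJ, hb.J_three hJ,
    map_neg, LinearMap.add_apply, LinearMap.smul_apply, smul_eq_mul, bilin_self,
    bilin_swap α (b 1) (b 0), bilin_swap α (b 2) (b 0), bilin_swap α (b 3) (b 0),
    bilin_swap α (b 2) (b 1), bilin_swap α (b 3) (b 1), bilin_swap α (b 3) (b 2)] at h13 h12 ⊢
  rw [h13, h12]
  ring

/-- An invariant 2-form is positive if and only if its Hermitian matrix is. -/
theorem invariant_tamed_iff (hb : IsAdaptedBasis J b) (hJ : IsAlmostComplex J)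
    {α : Form g 2} (hα : α ∈ invariantForms J) :
    (∀ v : g, v ≠ 0 → 0 < α ![v, J v]) ↔ 0 < α ![b 0, b 1] ∧
      0 < α ![b 0, b 1] * α ![b 2, b 3] - α ![b 0, b 2] ^ 2 - α ![b 0, b 3] ^ 2 := by
  constructor
  · intro h
    have ha : 0 < α ![b 0, b 1] := by
      rw [← hb.one]
      exact h _ (b.ne_zero 0)
    refine ⟨ha, ?_⟩
    set a := α ![b 0, b 1] with ha_def
    -- The test vector is the zero of both squares in the identity `key` below, taken at third
    -- coordinate `a` and fourth coordinate 0; the form's value there is `a` times the determinant.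
    have hx := h (-α ![b 0, b 3] • b 0 + -α ![b 0, b 2] • b 1 + a • b 2 + (0 : ℝ) • b 3) (by
      intro h0
      have := congrArg (fun x => b.repr x 2) h0
      simp [ha.ne'] at this)
    rw [invariant_apply_self_coords hb hJ hα, ← ha_def] at hx
    have : 0 < a * (a * α ![b 2, b 3] - α ![b 0, b 2] ^ 2 - α ![b 0, b 3] ^ 2) := by
      refine hx.trans_eq ?_
      ring
    exact (mul_pos_iff_of_pos_left ha).mp this
  · rintro ⟨ha, hd⟩ v hv
    have hv' := b.sum_repr v
    rw [Fin.sum_univ_four] at hv'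
    have hc := invariant_apply_self_coords hb hJ hα (b.repr v 0) (b.repr v 1) (b.repr v 2)
      (b.repr v 3)
    rw [hv'] at hc
    refine (mul_pos_iff_of_pos_left ha).mp ?_
    set a := α ![b 0, b 1]
    set c := α ![b 2, b 3]
    set p := α ![b 0, b 2]
    set q := α ![b 0, b 3]
    have key : a * α ![v, J v] = (a * b.repr v 0 + q * b.repr v 2 - p * b.repr v 3) ^ 2
        + (a * b.repr v 1 + p * b.repr v 2 + q * b.repr v 3) ^ 2
        + (a * c - p ^ 2 - q ^ 2) * (b.repr v 2 ^ 2 + b.repr v 3 ^ 2) := by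
      rw [hc]; ring
    rw [key]
    by_contra! hle
    have n1 := sq_nonneg (a * b.repr v 0 + q * b.repr v 2 - p * b.repr v 3)
    have n2 := sq_nonneg (a * b.repr v 1 + p * b.repr v 2 + q * b.repr v 3)
    have n3 : 0 ≤ (a * c - p ^ 2 - q ^ 2) * (b.repr v 2 ^ 2 + b.repr v 3 ^ 2) := by positivity
    have z3 : b.repr v 2 ^ 2 + b.repr v 3 ^ 2 = 0 := by
      have : (a * c - p ^ 2 - q ^ 2) * (b.repr v 2 ^ 2 + b.repr v 3 ^ 2) = 0 := by linarith
      simpa [hd.ne'] using this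
    have e2 : b.repr v 2 = 0 := by nlinarith [sq_nonneg (b.repr v 2), sq_nonneg (b.repr v 3)]
    have e3 : b.repr v 3 = 0 := by nlinarith [sq_nonneg (b.repr v 2), sq_nonneg (b.repr v 3)]
    have e0 : b.repr v 0 = 0 := by
      have : (a * b.repr v 0 + q * b.repr v 2 - p * b.repr v 3) ^ 2 = 0 := by linarith
      simpa [e2, e3, ha.ne'] using this
    have e1 : b.repr v 1 = 0 := by
      have : (a * b.repr v 1 + p * b.repr v 2 + q * b.repr v 3) ^ 2 = 0 := by linarith
      simpa [e2, e3, ha.ne'] using this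
    apply hv
    rw [← hv', e0, e1, e2, e3]
    simp

variable {F α : Form g 2}

theorem wedgePairing_self_pos_of_tamed (hb : IsAdaptedBasis J b) (hJ : IsAlmostComplex J)
    (hF : F ∈ invariantForms J) (hFt : ∀ v : g, v ≠ 0 → 0 < F ![v, J v]) :
    0 < wedgePairing (topVector b) F F := by
  rw [wedgePairing_invariant_self hb hJ hF]
  linarith [((invariant_tamed_iff hb hJ hF).mp hFt).2]

theorem wedgePairing_pos_of_tamed (hb : IsAdaptedBasis J b) (hJ : IsAlmostComplex J)
    (hF : F ∈ invariantForms J) (hFt : ∀ v : g, v ≠ 0 → 0 < F ![v, J v])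
    (hα : α ∈ invariantForms J) (hαt : ∀ v : g, v ≠ 0 → 0 < α ![v, J v]) :
    0 < wedgePairing (topVector b) α F := by
  rw [invariant_tamed_iff hb hJ hF] at hFt
  rw [invariant_tamed_iff hb hJ hα] at hαt
  rw [wedgePairing_invariant hb hJ hα hF]
  exact hermitian_pairing_pos hFt.1 hFt.2 hαt.1 hαt.2

/-- Two signs of pairings decide tamedness of an invariant form. For closed forms both depend only
on cohomology classes. -/
theorem tamed_of_wedgePairing_pos (hb : IsAdaptedBasis J b) (hJ : IsAlmostComplex J)
    (hF : F ∈ invariantForms J) (hFt : ∀ v : g, v ≠ 0 → 0 < F ![v, J v])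
    (hα : α ∈ invariantForms J) (hαα : 0 < wedgePairing (topVector b) α α)
    (hαF : 0 < wedgePairing (topVector b) α F) : ∀ v : g, v ≠ 0 → 0 < α ![v, J v] := by
  rw [invariant_tamed_iff hb hJ hF] at hFt
  rw [wedgePairing_invariant_self hb hJ hα] at hαα
  rw [wedgePairing_invariant hb hJ hα hF] at hαF
  rw [invariant_tamed_iff hb hJ hα]
  have hd := (mul_pos_iff_of_pos_left two_pos).mp hαα
  exact ⟨hermitian_pos_of_pairing_pos hFt.1 hFt.2 hd hαF, hd⟩

/-- The orthogonal complement of the timelike `F` is negative definite, so null vectors are excluded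
as well. -/
theorem invariant_eq_zero_of_orthogonal (hb : IsAdaptedBasis J b) (hJ : IsAlmostComplex J)
    (hF : F ∈ invariantForms J) (hFt : ∀ v : g, v ≠ 0 → 0 < F ![v, J v])
    (hα : α ∈ invariantForms J) (hαα : 0 ≤ wedgePairing (topVector b) α α)
    (hαF : wedgePairing (topVector b) α F = 0) : α = 0 := by
  rw [invariant_tamed_iff hb hJ hF] at hFt
  rw [wedgePairing_invariant_self hb hJ hα] at hαα
  rw [wedgePairing_invariant hb hJ hα hF] at hαF
  obtain ⟨h01, h23, h02, h03⟩ := hermitian_spacelike hFt.1 hFt.2 hαF (by linarith)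
  exact form_eq_zero_of_basis b h01 h02 h03 (by rw [hb.invariant_one_two hJ hα, h03, neg_zero])
    (by rw [hb.invariant_one_three hα, h02]) h23

end Adapted

/-! ### Existence of adapted bases -/

theorem exists_adaptedBasis_of_linearIndependent (h4 : Module.finrank ℝ g = 4) {J : g →ₗ[ℝ] g}
    {v w : g} (h : LinearIndependent ℝ ![v, J v, w, J w]) :
    ∃ b : Module.Basis (Fin 4) ℝ g, IsAdaptedBasis J b ∧ ⇑b = ![v, J v, w, J w] := by
  refine ⟨basisOfLinearIndependentOfCardEqFinrank h (by simp [h4]), ⟨?_, ?_⟩, ?_⟩ <;> simp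

theorem exists_adaptedBasis_of_inducesOrientation (h4 : Module.finrank ℝ g = 4) {J : g →ₗ[ℝ] g}
    {ζ : ⋀[ℝ]^4 g} (hζ : InducesOrientation J ζ) :
    ∃ b : Module.Basis (Fin 4) ℝ g, IsAdaptedBasis J b ∧ ζ = topVector b := by
  obtain ⟨h0, v, w, rfl⟩ := hζ
  have hli : LinearIndependent ℝ ![v, J v, w, J w] := by
    by_contra h
    exact h0 (AlternatingMap.map_linearDependent _ _ h)
  obtain ⟨b, hb, hbv⟩ := exists_adaptedBasis_of_linearIndependent h4 hli
  exact ⟨b, hb, by rw [topVector, hbv]⟩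

/-- Applying `s - t J` to `(s + t J) w` gives `(s ^ 2 + t ^ 2) w`, as with complex conjugates. -/
theorem eq_zero_of_combination_J {J : g →ₗ[ℝ] g} (hJ : IsAlmostComplex J) {W : Submodule ℝ g}
    (hW : ∀ x ∈ W, J x ∈ W) {w : g} (hw : w ∉ W) {s t : ℝ} (h : s • w + t • J w ∈ W) :
    s = 0 ∧ t = 0 := by
  have h2 : (s ^ 2 + t ^ 2) • w ∈ W := by
    have h3 := W.sub_mem (W.smul_mem s h) (W.smul_mem t (hW _ h))
    have : s • (s • w + t • J w) - t • J (s • w + t • J w) = (s ^ 2 + t ^ 2) • w := by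
      simp only [map_add, map_smul, hJ w]
      module
    rwa [this] at h3
  have h0 : s ^ 2 + t ^ 2 = 0 := by
    by_contra hne
    exact hw ((W.smul_mem_iff hne).mp h2)
  constructor <;> nlinarith [sq_nonneg s, sq_nonneg t]

theorem exists_adaptedBasis (h4 : Module.finrank ℝ g = 4) {J : g →ₗ[ℝ] g}
    (hJ : IsAlmostComplex J) : ∃ b : Module.Basis (Fin 4) ℝ g, IsAdaptedBasis J b := by
  have : Module.Finite ℝ g := Module.finite_of_finrank_eq_succ h4
  have : Nontrivial g := Module.nontrivial_of_finrank_pos (R := ℝ) (by omega)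
  obtain ⟨v, hv⟩ := exists_ne (0 : g)
  let W : Submodule ℝ g := Submodule.span ℝ {v, J v}
  have hW : ∀ x ∈ W, J x ∈ W := by
    intro x hx
    obtain ⟨s, t, rfl⟩ := Submodule.mem_span_pair.mp hx
    rw [Submodule.mem_span_pair]
    refine ⟨-t, s, ?_⟩
    simp only [map_add, map_smul, hJ v]
    module
  obtain ⟨w, hw⟩ : ∃ w, w ∉ W := by
    by_contra! h
    have h2 : Module.finrank ℝ W ≤ 2 := by
      classical
      have := finrank_span_finset_le_card (R := ℝ) ({v, J v} : Finset g)
      simp only [Finset.coe_insert, Finset.coe_singleton] at this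
      exact this.trans Finset.card_le_two
    rw [(Submodule.eq_top_iff').mpr h, finrank_top] at h2
    omega
  have hli : LinearIndependent ℝ ![v, J v, w, J w] := by
    rw [Fintype.linearIndependent_iff]
    intro c hc
    rw [Fin.sum_univ_four] at hc
    simp only [Matrix.cons_val] at hc
    have h23 : c 2 • w + c 3 • J w ∈ W := by
      have : c 2 • w + c 3 • J w = -(c 0 • v + c 1 • J v) := by
        rw [eq_neg_iff_add_eq_zero, ← hc]; abel
      rw [this]
      exact W.neg_mem (Submodule.mem_span_pair.mpr ⟨_, _, rfl⟩)
    obtain ⟨e2, e3⟩ := eq_zero_of_combination_J hJ hW hw h23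
    have h01 : c 0 • v + c 1 • J v ∈ (⊥ : Submodule ℝ g) := by
      simpa [e2, e3] using hc
    -- The same argument modulo the zero subspace treats the complex line of `v`.
    obtain ⟨e0, e1⟩ := eq_zero_of_combination_J hJ (W := ⊥) (by simp) (by simpa using hv) h01
    intro i
    fin_cases i <;> assumption
  obtain ⟨b, hb, -⟩ := exists_adaptedBasis_of_linearIndependent h4 hli
  exact ⟨b, hb⟩

/-! ### Closed forms as the orthogonal complement of the exact ones -/

/-- On a unimodular Lie algebra, `α ∧ dφ` is the product of `φ` with `dα`. -/
theorem wedge_dOne_basis (hu : IsUnimodular g) (b : Module.Basis (Fin 4) ℝ g) (α : Form g 2)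
    (φ : Module.Dual ℝ g) :
    wedge α (dOne φ) b = -(φ (b 3) * dTwo α ![b 0, b 1, b 2] - φ (b 2) * dTwo α ![b 0, b 1, b 3]
      + φ (b 1) * dTwo α ![b 0, b 2, b 3] - φ (b 0) * dTwo α ![b 1, b 2, b 3]) := by
  obtain ⟨c, hc⟩ : ∃ c : Fin 4 → Fin 4 → Fin 4 → ℝ, ∀ i j k, c i j k = b.repr ⁅b i, b j⁆ k :=
    ⟨_, fun _ _ _ => rfl⟩
  have hbr : ∀ i j, ⁅b i, b j⁆ =
      c i j 0 • b 0 + c i j 1 • b 1 + c i j 2 • b 2 + c i j 3 • b 3 := by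
    intro i j
    rw [hc, hc, hc, hc, ← Fin.sum_univ_four (fun k => b.repr ⁅b i, b j⁆ k • b k), b.sum_repr]
  have hcs : ∀ i j k, c i j k = -c j i k := by
    intro i j k
    rw [hc, hc, ← lie_skew (b i) (b j), map_neg, Finsupp.neg_apply]
  have hcz : ∀ i k, c i i k = 0 := by
    intro i k
    rw [hc]
    simp
  have htr : ∀ i, c i 0 0 + c i 1 1 + c i 2 2 + c i 3 3 = 0 := by
    intro i
    have h := hu (b i)
    rw [LinearMap.trace_eq_matrix_trace ℝ b, Matrix.trace, Fin.sum_univ_four] at h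
    simpa [Matrix.diag, LinearMap.toMatrix_apply, hc] using h
  have t0 := htr 0
  have t1 := htr 1
  have t2 := htr 2
  have t3 := htr 3
  have hd : ∀ i j, (dOne φ) ![b i, b j] =
      -(c i j 0 * φ (b 0) + c i j 1 * φ (b 1) + c i j 2 * φ (b 2) + c i j 3 * φ (b 3)) := by
    intro i j
    simp [dOne_apply, hbr i j]
  rw [wedge_apply]
  simp only [hd, dTwo_apply, Matrix.cons_val]
  clear hd htr hc
  simp only [← bilin_apply]
  simp only [hbr, map_add, map_smul, LinearMap.add_apply, LinearMap.smul_apply, smul_eq_mul,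
    bilin_self, bilin_swap α (b 1) (b 0), bilin_swap α (b 2) (b 0), bilin_swap α (b 3) (b 0),
    bilin_swap α (b 2) (b 1), bilin_swap α (b 3) (b 1), bilin_swap α (b 3) (b 2)]
  simp only [hcs 1 0, hcs 2 0, hcs 3 0, hcs 2 1, hcs 3 1, hcs 3 2, hcz] at t0 t1 t2 t3
  -- The two sides differ by `d(α ∧ φ)` up to sign: each trace of `ad (b i)` multiplies the
  -- component of `α ∧ φ` on the three other basis vectors.
  linear_combination
    (-1 : ℝ) * (t0 * (bilin α (b 1) (b 2) * φ (b 3) - bilin α (b 1) (b 3) * φ (b 2)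
        + bilin α (b 2) (b 3) * φ (b 1))
      - t1 * (bilin α (b 0) (b 2) * φ (b 3) - bilin α (b 0) (b 3) * φ (b 2)
        + bilin α (b 2) (b 3) * φ (b 0))
      + t2 * (bilin α (b 0) (b 1) * φ (b 3) - bilin α (b 0) (b 3) * φ (b 1)
        + bilin α (b 1) (b 3) * φ (b 0))
      - t3 * (bilin α (b 0) (b 1) * φ (b 2) - bilin α (b 0) (b 2) * φ (b 1)
        + bilin α (b 1) (b 2) * φ (b 0)))

theorem form_three_eq_zero_of_basis (b : Module.Basis (Fin 4) ℝ g) {η : Form g 3}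
    (h012 : η ![b 0, b 1, b 2] = 0) (h013 : η ![b 0, b 1, b 3] = 0)
    (h023 : η ![b 0, b 2, b 3] = 0) (h123 : η ![b 1, b 2, b 3] = 0) : η = 0 := by
  have hsort : ∀ i j k : Fin 4, i < j → j < k → η ![b i, b j, b k] = 0 := by
    intro i j k hij hjk
    fin_cases i <;> fin_cases j <;> fin_cases k <;> first | assumption | simp at hij hjk
  have s01 : ∀ x y z : g, η ![x, y, z] = -η ![y, x, z] := by
    intro x y z
    rw [← η.map_swap ![y, x, z] (i := 0) (j := 1) (by decide)]
    congr 1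
    ext i
    fin_cases i <;> rfl
  have s12 : ∀ x y z : g, η ![x, y, z] = -η ![x, z, y] := by
    intro x y z
    rw [← η.map_swap ![x, z, y] (i := 1) (j := 2) (by decide)]
    congr 1
    ext i
    fin_cases i <;> rfl
  refine Module.Basis.ext_alternating b fun f hf => ?_
  have hfb : (fun i => b (f i)) = ![b (f 0), b (f 1), b (f 2)] := by
    ext i; fin_cases i <;> rfl
  rw [hfb, AlternatingMap.zero_apply]
  have n01 : f 0 ≠ f 1 := hf.ne (by decide)
  have n12 : f 1 ≠ f 2 := hf.ne (by decide)
  have n02 : f 0 ≠ f 2 := hf.ne (by decide)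
  generalize f 0 = i at *
  generalize f 1 = j at *
  generalize f 2 = k at *
  rcases lt_or_gt_of_ne n01 with h1 | h1 <;> rcases lt_or_gt_of_ne n12 with h2 | h2 <;>
    rcases lt_or_gt_of_ne n02 with h3 | h3
  · exact hsort _ _ _ h1 h2
  · exact absurd (h1.trans h2) h3.not_gt
  · rw [s12, hsort _ _ _ h3 h2, neg_zero]
  · rw [s12, s01, hsort _ _ _ h3 h1, neg_zero, neg_zero]
  · rw [s01, hsort _ _ _ h1 h3, neg_zero]
  · rw [s01, s12, hsort _ _ _ h2 h3, neg_zero, neg_zero]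
  · exact absurd (h2.trans h1) h3.not_gt
  · rw [s01, s12, s01, hsort _ _ _ h2 h1, neg_zero, neg_zero, neg_zero]

/-- A 2-form orthogonal to the exact forms is closed. -/
theorem dTwo_eq_zero_of_orthogonal (hu : IsUnimodular g) (b : Module.Basis (Fin 4) ℝ g)
    {α : Form g 2} (h : ∀ φ, wedgePairing (topVector b) α (dOne φ) = 0) : dTwo α = 0 := by
  have h' : ∀ φ, wedge α (dOne φ) b = 0 := by
    intro φ
    rw [← h φ, wedgePairing_apply, topVector, exteriorPower.alternatingMapLinearEquiv_apply_ιMulti]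
  -- Each coordinate functional isolates one component of `dTwo α` in `wedge_dOne_basis`.
  have h0 := h' (b.coord 0)
  have h1 := h' (b.coord 1)
  have h2 := h' (b.coord 2)
  have h3 := h' (b.coord 3)
  rw [wedge_dOne_basis hu b] at h0 h1 h2 h3
  simp at h0 h1 h2 h3
  exact form_three_eq_zero_of_basis b h3 h2 h1 h0

theorem wedgePairing_closed_exact (h4 : Module.finrank ℝ g = 4) (hu : IsUnimodular g)
    (ζ : ⋀[ℝ]^4 g) {α : Form g 2} (hα : dTwo α = 0) (φ : Module.Dual ℝ g) :
    wedgePairing ζ α (dOne φ) = 0 := by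
  rw [wedgePairing_apply, wedge_exact_eq_zero h4 hu hα φ, map_zero, LinearMap.zero_apply]

/-! ### The decomposition of closed forms -/

section Decomposition

variable {J : g →ₗ[ℝ] g} {b : Module.Basis (Fin 4) ℝ g}

theorem wedgePairing_invariantPart (hb : IsAdaptedBasis J b) (hJ : IsAlmostComplex J)
    (α β : Form g 2) :
    wedgePairing (topVector b) (invariantPart J α) β =
      wedgePairing (topVector b) (invariantPart J α) (invariantPart J β) := by
  have h := wedgePairing_invariant_antiInvariant hb hJ (invariantPart_mem hJ α)
    (sub_invariantPart_mem hJ β)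
  rw [map_sub] at h
  linarith

theorem wedgePairing_add_parts (hb : IsAdaptedBasis J b) (hJ : IsAlmostComplex J)
    (α β : Form g 2) :
    wedgePairing (topVector b) α β =
      wedgePairing (topVector b) (invariantPart J α) (invariantPart J β) +
      wedgePairing (topVector b) (α - invariantPart J α) (β - invariantPart J β) := by
  have h1 := wedgePairing_invariantPart hb hJ α β
  have h2 := wedgePairing_invariantPart hb hJ β α
  rw [wedgePairing_comm _ _ α, wedgePairing_comm _ _ (invariantPart J α)] at h2
  simp only [map_sub, LinearMap.sub_apply]
  linarith

/-- An exact form is closed, hence orthogonal to itself, so the squares of its two parts cancel. -/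
theorem wedgePairing_exact_self (h4 : Module.finrank ℝ g = 4) (hu : IsUnimodular g)
    (hb : IsAdaptedBasis J b) (hJ : IsAlmostComplex J) (φ : Module.Dual ℝ g) :
    wedgePairing (topVector b) (invariantPart J (dOne φ)) (invariantPart J (dOne φ)) =
      -wedgePairing (topVector b) (dOne φ - invariantPart J (dOne φ))
        (dOne φ - invariantPart J (dOne φ)) := by
  have h := wedgePairing_add_parts hb hJ (dOne φ) (dOne φ)
  rw [wedgePairing_closed_exact h4 hu _ (dTwo_dOne φ)] at h
  linarith

theorem wedgePairing_invariantPart_exact_nonpos (h4 : Module.finrank ℝ g = 4)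
    (hu : IsUnimodular g) (hb : IsAdaptedBasis J b) (hJ : IsAlmostComplex J)
    (φ : Module.Dual ℝ g) :
    wedgePairing (topVector b) (invariantPart J (dOne φ)) (invariantPart J (dOne φ)) ≤ 0 := by
  rw [wedgePairing_exact_self h4 hu hb hJ,
    wedgePairing_antiInvariant_self hb hJ (sub_invariantPart_mem hJ _), neg_nonpos]
  positivity

theorem invariantPart_tamed (hJ : IsAlmostComplex J) {ω : ClosedForm g} (hω : IsTamedForm J ω)
    (v : g) (hv : v ≠ 0) : 0 < invariantPart J ω.form ![v, J v] := by
  rw [invariantPart_apply_self hJ]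
  exact hω v hv

/-- The invariant parts of the exact forms span a negative definite subspace if `J` is tamed. -/
theorem exact_eq_zero_of_invariantPart_null (h4 : Module.finrank ℝ g = 4) (hu : IsUnimodular g)
    (hb : IsAdaptedBasis J b) (hJ : IsAlmostComplex J) (hT : IsTamed J) (φ : Module.Dual ℝ g)
    (h : wedgePairing (topVector b) (invariantPart J (dOne φ)) (invariantPart J (dOne φ)) = 0) :
    dOne φ = 0 := by
  obtain ⟨ω, hω⟩ := hT
  have hanti : dOne φ - invariantPart J (dOne φ) = 0 := by
    refine antiInvariant_eq_zero_of_self hb hJ (sub_invariantPart_mem hJ _) ?_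
    rw [wedgePairing_exact_self h4 hu hb hJ] at h
    linarith
  have hinv := sub_eq_zero.mp hanti
  have hmem : dOne φ ∈ invariantForms J := hinv ▸ invariantPart_mem hJ (dOne φ)
  -- Now `dOne φ` is invariant and null. It is orthogonal to the closed `ω`, hence to the timelike
  -- invariant part of `ω`.
  refine invariant_eq_zero_of_orthogonal hb hJ (invariantPart_mem hJ ω.form)
    (invariantPart_tamed hJ hω) hmem ?_ ?_
  · rw [wedgePairing_closed_exact h4 hu _ (dTwo_dOne φ)]
  · rw [wedgePairing_comm, wedgePairing_invariantPart hb hJ]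
    have h1 := wedgePairing_add_parts hb hJ ω.form (dOne φ)
    rw [hanti, map_zero, add_zero, wedgePairing_closed_exact h4 hu _ ω.dTwo_form] at h1
    exact h1.symm

/-- If `J` is tamed, every closed 2-form is cohomologous to one whose invariant part is closed and
orthogonal to the invariant parts of the exact forms. -/
theorem exists_exact_add_closed_parts (h4 : Module.finrank ℝ g = 4) (hu : IsUnimodular g)
    (hb : IsAdaptedBasis J b) (hJ : IsAlmostComplex J) (hT : IsTamed J) (α : Form g 2) :
    ∃ φ : Module.Dual ℝ g, dTwo (invariantPart J (α + dOne φ)) = 0 ∧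
      ∀ ψ : Module.Dual ℝ g, wedgePairing (topVector b) (invariantPart J (α + dOne φ))
        (invariantPart J (dOne ψ)) = 0 := by
  have : Module.Finite ℝ g := Module.finite_of_finrank_eq_succ h4
  obtain ⟨_, ⟨φ, rfl⟩, hφ⟩ := exists_add_orthogonal_of_anisotropic
    ((wedgePairing (topVector b)).compl₁₂ (invariantPart J) (invariantPart J))
    (LinearMap.range (dOne (g := g))) (by
      rintro _ ⟨ψ, rfl⟩ h
      exact exact_eq_zero_of_invariantPart_null h4 hu hb hJ hT ψ h) α
  have horth : ∀ ψ : Module.Dual ℝ g, wedgePairing (topVector b) (invariantPart J (α + dOne φ))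
      (invariantPart J (dOne ψ)) = 0 := fun ψ => hφ _ ⟨ψ, rfl⟩
  -- An invariant form pairs with `dOne ψ` only through the invariant part of `dOne ψ`, so `horth`
  -- is orthogonality to all exact forms.
  refine ⟨φ, dTwo_eq_zero_of_orthogonal hu b fun ψ => ?_, horth⟩
  rw [wedgePairing_invariantPart hb hJ, horth]

theorem cls_add_dOne (ω : ClosedForm g) (φ : Module.Dual ℝ g) :
    cls (ω + ClosedForm.mk (dOne φ) (dTwo_dOne φ)) = cls ω := by
  have h : cls (ClosedForm.mk (dOne φ) (dTwo_dOne φ)) = 0 :=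
    (Submodule.Quotient.mk_eq_zero _).mpr ⟨φ, rfl⟩
  rw [map_add, h, add_zero]

theorem compatibleCone_add_HMinus_subset (hJ : IsAlmostComplex J) :
    compatibleCone J + (HMinus J : Set (H2 g)) ⊆ tamedCone J := by
  rintro _ ⟨_, ⟨-, ω, hω, rfl⟩, _, ⟨β, hβ, rfl⟩, rfl⟩
  refine ⟨ω + β, fun v hv => ?_, map_add _ _ _⟩
  rw [map_add, AlternatingMap.add_apply, antiInvariant_apply_self hJ hβ, add_zero]
  exact hω.1 v hv

theorem IsCompatibleForm.cls_mem {ω : ClosedForm g} (hω : IsCompatibleForm J ω) :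
    cls ω ∈ compatibleCone J :=
  ⟨⟨ω, hω.2, rfl⟩, ω, hω, rfl⟩

theorem tamedCone_subset (h4 : Module.finrank ℝ g = 4) (hu : IsUnimodular g)
    (hJ : IsAlmostComplex J) :
    tamedCone J ⊆ compatibleCone J + (HMinus J : Set (H2 g)) := by
  rintro _ ⟨ω, hω, rfl⟩
  obtain ⟨b, hb⟩ := exists_adaptedBasis h4 hJ
  obtain ⟨φ, hcl, horth⟩ := exists_exact_add_closed_parts h4 hu hb hJ ⟨ω, hω⟩ ω.form
  let z : ClosedForm g := ClosedForm.mk _ hcl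
  let ω' : ClosedForm g := ω + ClosedForm.mk (dOne φ) (dTwo_dOne φ)
  have hFt := invariantPart_tamed hJ hω
  have hF := invariantPart_mem hJ ω.form
  have hFF := wedgePairing_self_pos_of_tamed hb hJ hF hFt
  have hbb := wedgePairing_invariantPart_exact_nonpos h4 hu hb hJ φ
  have hzb := horth φ
  have hsymm := wedgePairing_comm (topVector b) (invariantPart J ω.form) (invariantPart J (dOne φ))
  -- Write `z = F + B` with `F`, `B` the invariant parts of `ω` and `dOne φ`. Since `z` is
  -- orthogonal to `B`, both `z·z` and `z·F` equal `F·F - B·B`, which is at least `F·F > 0`.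
  have hz : IsCompatibleForm J z := by
    refine ⟨tamed_of_wedgePairing_pos hb hJ hF hFt (invariantPart_mem hJ _) ?_ ?_,
      invariantPart_mem hJ _⟩ <;>
    · simp only [z, ClosedForm.form_mk, map_add, LinearMap.add_apply] at hzb ⊢
      linarith
  refine Set.mem_add.mpr ⟨cls z, hz.cls_mem, cls (ω' - z), ⟨ω' - z, ?_, rfl⟩, ?_⟩
  · exact sub_invariantPart_mem hJ (ω.form + dOne φ)
  · rw [← map_add, add_sub_cancel, cls_add_dOne]

end Decomposition

/-! ### The compatible cone as a connected component -/

section Cone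

variable {J : g →ₗ[ℝ] g} {b : Module.Basis (Fin 4) ℝ g}

theorem convex_compatibleCone (J : g →ₗ[ℝ] g) : Convex ℝ (compatibleCone J) := by
  rintro _ ⟨-, ω, hω, rfl⟩ _ ⟨-, η, hη, rfl⟩ s t hs ht hst
  have h : IsCompatibleForm J (s • ω + t • η) := by
    refine ⟨fun v hv => ?_, ?_⟩
    · have h1 := hω.1 v hv
      have h2 := hη.1 v hv
      simp only [map_add, map_smul, AlternatingMap.add_apply, AlternatingMap.smul_apply,
        smul_eq_mul]
      rcases hs.lt_or_eq with hs | rfl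
      · exact add_pos_of_pos_of_nonneg (mul_pos hs h1) (mul_nonneg ht h2.le)
      · obtain rfl : t = 1 := by linarith
        simpa using h2
    · rw [map_add, map_smul, map_smul]
      exact add_mem (Submodule.smul_mem _ _ hω.2) (Submodule.smul_mem _ _ hη.2)
  have := h.cls_mem
  rwa [map_add, map_smul, map_smul] at this

/-- Both conditions on the right concern classes alone, so every closed invariant representative of
such a class is compatible. -/
theorem compatibleCone_eq (h4 : Module.finrank ℝ g = 4) (hu : IsUnimodular g)
    (hb : IsAdaptedBasis J b) (hJ : IsAlmostComplex J) {F : ClosedForm g}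
    (hF : IsCompatibleForm J F) :
    compatibleCone J = positiveClasses h4 hu (topVector b) J ∩
      {e | 0 < cohomologyPairing h4 hu (topVector b) e (cls F)} := by
  ext e
  constructor
  · rintro ⟨he, ω, hω, rfl⟩
    refine ⟨⟨he, ?_⟩, ?_⟩
    · rw [cohomologyPairing_cls]
      exact wedgePairing_self_pos_of_tamed hb hJ hω.2 hω.1
    · rw [Set.mem_ofPred_eq, cohomologyPairing_cls]
      exact wedgePairing_pos_of_tamed hb hJ hF.2 hF.1 hω.2 hω.1
  · rintro ⟨⟨⟨α, hα, rfl⟩, h1⟩, h2⟩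
    rw [cohomologyPairing_cls] at h1
    rw [Set.mem_ofPred_eq, cohomologyPairing_cls] at h2
    have hc : IsCompatibleForm J α := ⟨tamed_of_wedgePairing_pos hb hJ hF.2 hF.1 hα h1 h2, hα⟩
    exact hc.cls_mem

/-- The hyperplane orthogonal to `cls F` cuts the positive classes into two disjoint open sides. -/
theorem cohomologyPairing_ne_zero_of_mem_positiveClasses (h4 : Module.finrank ℝ g = 4)
    (hu : IsUnimodular g) (hb : IsAdaptedBasis J b) (hJ : IsAlmostComplex J) {F : ClosedForm g}
    (hF : IsCompatibleForm J F) {e : H2 g} (he : e ∈ positiveClasses h4 hu (topVector b) J) :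
    cohomologyPairing h4 hu (topVector b) e (cls F) ≠ 0 := by
  obtain ⟨⟨α, hα, rfl⟩, h1⟩ := he
  rw [cohomologyPairing_cls] at h1 ⊢
  intro h2
  have h0 := invariant_eq_zero_of_orthogonal hb hJ hF.2 hF.1 hα h1.le h2
  rw [h0, map_zero] at h1
  exact lt_irrefl _ h1

instance : IsModuleTopology ℝ (H2 g) := ⟨rfl⟩

theorem compatibleCone_eq_connectedComponentIn (h4 : Module.finrank ℝ g = 4) (hu : IsUnimodular g)
    (hb : IsAdaptedBasis J b) (hJ : IsAlmostComplex J) {F : ClosedForm g}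
    (hF : IsCompatibleForm J F) :
    compatibleCone J =
      connectedComponentIn (positiveClasses h4 hu (topVector b) J) (cls F) := by
  have hKP := compatibleCone_eq h4 hu hb hJ hF
  have : ContinuousAdd (H2 g) := IsModuleTopology.toContinuousAdd ℝ (H2 g)
  have : ContinuousSMul ℝ (H2 g) := IsModuleTopology.toContinuousSMul ℝ (H2 g)
  have hFmem : cls F ∈ positiveClasses h4 hu (topVector b) J := (hKP ▸ hF.cls_mem).1
  refine Set.Subset.antisymm ?_ fun e he => ?_
  · exact (convex_compatibleCone J).isPreconnected.subset_connectedComponentIn hF.cls_mem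
      (hKP ▸ Set.inter_subset_left)
  · have hsub := connectedComponentIn_subset (positiveClasses h4 hu (topVector b) J) (cls F)
    let f : H2 g →ₗ[ℝ] ℝ := (cohomologyPairing h4 hu (topVector b)).flip (cls F)
    have hf : Continuous f := IsModuleTopology.continuous_of_linearMap f
    rw [hKP]
    refine ⟨hsub he, ?_⟩
    by_contra hneg
    have hFpos : 0 < f (cls F) := hFmem.2
    -- A component reaching the other side would contain a zero of `f`, by the intermediate value
    -- theorem.
    obtain ⟨x, hx, hx0⟩ := isPreconnected_connectedComponentIn.intermediate_value he
      (mem_connectedComponentIn hFmem) hf.continuousOn ⟨not_lt.mp hneg, hFpos.le⟩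
    exact cohomologyPairing_ne_zero_of_mem_positiveClasses h4 hu hb hJ hF (hsub hx) hx0

end Cone

end LieACS

end

theorem theorem3p10 {g : Type*} [LieRing g] [LieAlgebra ℝ g]
    (h4 : Module.finrank ℝ g = 4) (hu : LieACS.IsUnimodular g)
    (J : g →ₗ[ℝ] g) (hJ : LieACS.IsAlmostComplex J) (hT : LieACS.IsTamed J) :
    (∀ ζ : ⋀[ℝ]^4 g, LieACS.InducesOrientation J ζ →
      ∃ e ∈ LieACS.positiveClasses h4 hu ζ J,
        LieACS.compatibleCone J =
          connectedComponentIn (LieACS.positiveClasses h4 hu ζ J) e) ∧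
    LieACS.tamedCone J = LieACS.compatibleCone J + (LieACS.HMinus J : Set (LieACS.H2 g)) := by
  have hcone := LieACS.tamedCone_subset h4 hu hJ
  refine ⟨fun ζ hζ => ?_, hcone.antisymm (LieACS.compatibleCone_add_HMinus_subset hJ)⟩
  obtain ⟨ω, hω⟩ := hT
  -- The decomposition of the class of a tamed form supplies the compatible form `F`, so tamed
  -- implies compatible here.
  obtain ⟨_, ⟨-, F, hF, rfl⟩, -⟩ := Set.mem_add.mp (hcone ⟨ω, hω, rfl⟩)
  obtain ⟨b, hb, rfl⟩ := LieACS.exists_adaptedBasis_of_inducesOrientation h4 hζ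
  exact ⟨LieACS.cls F, (LieACS.compatibleCone_eq h4 hu hb hJ hF ▸ hF.cls_mem).1,
    LieACS.compatibleCone_eq_connectedComponentIn h4 hu hb hJ hF⟩
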